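/- Let $\mathcal{M}=\langle \Sigma \mid ab=ba \ \text{for all } (a,b)\in I\rangle$ be a trace monoid, where $\Sigma$ is a finite alphabet and $I\subseteq\Sigma\times\Sigma$ is an irreflexive and symmetric relation, and let $|x|$ denote the length of a trace $x\in\mathcal{M}$. Let $(\mathcal{M},X,\bot)$ be a concurrent system: $X$ is a finite set of states, $\bot\notin X$, and $\mathcal{M}$ acts on the right on $X\cup\{\bot\}$ with $\bot\cdot x=\bot$ for all $x\in\mathcal{M}$. For $\alpha,\beta\in X$ let $r_{\alpha,\beta}\in(0,+\infty]$ be the radius of convergence of the growth series $$G_{\alpha,\beta}(z)=\sum_{n\ge 0}\#\{x\in\mathcal{M} : \alpha\cdot x=\beta,\ |x|=n\}\,z^n ,$$ and let the characteristic root of the system be $r=\min_{(\alpha,\beta)\in X\times X} r_{\alpha,\beta}\in(0,+\infty]$ (with $r=+\infty$ if $X=\emptyset$). A clique is a trace of the form $c=a_1\cdots a_p$ with letters $a_1,\dots,a_p$ such that $(a_i,a_j)\in I$ for all $i\ne j$. For non-empty cliques $c=a_1\cdots a_p$ and $d=b_1\cdots b_q$, written in this way, write $c\to d$ if for every $b_j$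 there is an $a_i$ with $(a_i,b_j)\notin I$. The digraph of states-and-cliques has as nodes all pairs $(\alpha,c)$ where $\alpha\in X$ and $c$ is a non-empty clique with $\alpha\cdot c\neq\bot$; there is an arc from $(\alpha,c)$ to $(\beta,d)$ if and only if $\beta=\alpha\cdot c$ and $c\to d$. The augmented digraph of states-and-cliques has as nodes all triples $(\alpha,c,i)$ where $(\alpha,c)$ is a node of the digraph of states-and-cliques and $i\in\{1,\dots,|c|\}$; there is an arc from $(\alpha,c,i)$ to $(\beta,d,j)$ if and only if either $(\alpha,c)=(\beta,d)$ and $j=i+1$, or $i=|c|$, $j=1$ and there is an arc from $(\alpha,c)$ to $(\beta,d)$ in the digraph of states-and-cliques. Let $\rho$ be the spectral radius of the augmented digraph of states-and-cliques, that is, the maximal modulus of the complex eigenvalues of its $\{0,1\}$-valued adjacency matrix (with $\rho=0$ if the digraph has no nodes). Then $r=1/\rho$ if $\rho\neq 0$, and $r=+\infty$ if $\rho=0$. -/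

import Mathlib

open scoped ENNReal

/-- The adjacency matrix of a digraph: the `0`-`1` matrix whose entry at `(x, y)` is `1` exactly
when there is an arc from `x` to `y`. -/
noncomputable def Digraph.adjacencyMatrix {V : Type*} (G : Digraph V) : Matrix V V ℂ :=
  open Classical in Matrix.of fun x y => if G.Adj x y then 1 else 0

/-- The spectral radius of a finite digraph: the largest modulus of a complex eigenvalue
of its adjacency matrix. -/
noncomputable def Digraph.specRadius {V : Type*} [Fintype V] (G : Digraph V) : ℝ≥0∞ :=
  open Classical in spectralRadius ℂ G.adjacencyMatrix

/-- The commutation relations `ab = ba` for `(a, b) ∈ I`. An independence relation, that is, an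
irreflexive and symmetric relation on the alphabet `A`, is given as a `SimpleGraph A`. -/
inductive TraceRel {A : Type*} (I : SimpleGraph A) : FreeMonoid A → FreeMonoid A → Prop
  | swap {a b : A} (h : I.Adj a b) :
      TraceRel I (FreeMonoid.of a * FreeMonoid.of b) (FreeMonoid.of b * FreeMonoid.of a)

/-- The trace monoid `⟨A | ab = ba for (a, b) ∈ I⟩`. -/
abbrev TraceMonoid {A : Type*} (I : SimpleGraph A) : Type _ :=
  PresentedMonoid (TraceRel I)

namespace TraceMonoid

variable {A : Type*} {I : SimpleGraph A}

/-- The trace represented by a word. -/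
def ofWord (I : SimpleGraph A) (w : List A) : TraceMonoid I :=
  PresentedMonoid.mk (TraceRel I) (FreeMonoid.ofList w)

/-- The length of a trace, as a monoid homomorphism to `(ℕ, +)` that maps every letter to `1`. -/
def lengthHom (I : SimpleGraph A) : TraceMonoid I →* Multiplicative ℕ :=
  PresentedMonoid.lift (fun _ : A => Multiplicative.ofAdd 1) (by
    rintro _ _ ⟨h⟩
    simp)

/-- The length of a trace: the length of any word representing it. -/
def length (x : TraceMonoid I) : ℕ :=
  (lengthHom I x).toAdd

theorem length_ofWord (w : List A) : length (ofWord I w) = w.length := by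
  induction w with
  | nil => simp [length, ofWord]
  | cons a w ih =>
    have h : ofWord I (a :: w) = PresentedMonoid.of (TraceRel I) a * ofWord I w := rfl
    have h1 : lengthHom I (PresentedMonoid.of (TraceRel I) a) = Multiplicative.ofAdd 1 := rfl
    unfold length at ih ⊢
    rw [h, map_mul, h1, toAdd_mul, ih, List.length_cons, toAdd_ofAdd, add_comm]

/-- `IsCliqueWord c l` says that `l = [a₁, …, aₚ]` is a list of pairwise independent letters
(`(aᵢ, aⱼ) ∈ I` for `i ≠ j`) with `c = a₁ ⋯ aₚ`. -/
def IsCliqueWord (c : TraceMonoid I) (l : List A) : Prop :=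
  l.Pairwise I.Adj ∧ c = ofWord I l

/-- A clique is a trace that can be written as a product of pairwise commuting letters. -/
def IsClique (c : TraceMonoid I) : Prop :=
  ∃ l : List A, IsCliqueWord c l

/-- The relation `c → d` between cliques (normal form): `c = a₁ ⋯ aₚ` and `d = b₁ ⋯ b_q`, and for
every letter `bⱼ` there is a letter `aᵢ` such that `(aᵢ, bⱼ) ∉ I`. The writings of `c` and `d` are
unique up to order. -/
def NormalPair (c d : TraceMonoid I) : Prop :=
  ∃ l m : List A, IsCliqueWord c l ∧ IsCliqueWord d m ∧ ∀ b ∈ m, ∃ a ∈ l, ¬ I.Adj a b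

theorem finite_isClique [Finite A] (I : SimpleGraph A) :
    {c : TraceMonoid I | IsClique c}.Finite := by
  classical
  have := Fintype.ofFinite A
  refine (Set.finite_range fun l : {l : List A // l.Nodup} => ofWord I l.1).subset ?_
  rintro c ⟨l, hl, rfl⟩
  exact ⟨⟨l, hl.imp fun h => h.ne⟩, rfl⟩

end TraceMonoid

/-- A concurrent system `(M, X, ⊥)`: a right action of the trace monoid `M = M(A, I)` on
`X ∪ {⊥}` that fixes `⊥`. -/
structure ConcurrentSystem {A : Type*} (I : SimpleGraph A) (X : Type*) where
  /-- The action `(α, x) ↦ α · x`. -/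
  act : WithBot X → TraceMonoid I → WithBot X
  act_one : ∀ α, act α 1 = α
  act_mul : ∀ α x y, act (act α x) y = act α (x * y)
  act_bot : ∀ x, act ⊥ x = ⊥

namespace ConcurrentSystem

variable {A X : Type*} {I : SimpleGraph A} (S : ConcurrentSystem I X)

/-- The set `M_{α,β}(n)` of executions of length `n` that lead from `α` to `β`. -/
def executions (α β : X) (n : ℕ) : Set (TraceMonoid I) :=
  {x | S.act α x = β ∧ x.length = n}

/-- The radius of convergence of the growth series `∑ₙ #M_{α,β}(n) zⁿ`. -/
noncomputable def growthRadius (α β : X) : ℝ≥0∞ :=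
  (FormalMultilinearSeries.ofScalars ℂ
    fun n : ℕ => ((S.executions α β n).ncard : ℂ)).radius

/-- The characteristic root: the least radius of convergence of the growth series. -/
noncomputable def characteristicRoot : ℝ≥0∞ :=
  ⨅ (α : X) (β : X), S.growthRadius α β

/-- The nodes of the digraph of states-and-cliques: the pairs `(α, c)` of a state `α` and a non
empty clique `c` with `α · c ≠ ⊥`. -/
def DSCNode : Type _ :=
  {p : X × TraceMonoid I // p.2.IsClique ∧ p.2 ≠ 1 ∧ S.act p.1 p.2 ≠ ⊥}

variable {S} in
/-- The state of a node. -/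
def DSCNode.state (v : S.DSCNode) : X := v.1.1

variable {S} in
/-- The clique of a node. -/
def DSCNode.clique (v : S.DSCNode) : TraceMonoid I := v.1.2

/-- The digraph of states-and-cliques: there is an arc from `(α, c)` to `(β, d)` if and only if
`β = α · c` and `c → d`. -/
def DSC : Digraph S.DSCNode where
  Adj v w := (w.state : WithBot X) = S.act v.state v.clique ∧
    TraceMonoid.NormalPair v.clique w.clique

/-- The nodes of the augmented digraph of states-and-cliques: the triples `(α, c, i)` where
`(α, c)` is a node of the digraph of states-and-cliques and `1 ≤ i ≤ |c|`. -/
def ADSCNode : Type _ :=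
  (v : S.DSCNode) × {i : ℕ // i ∈ Finset.Icc 1 v.clique.length}

/-- The augmented digraph of states-and-cliques: there is an arc from `(α, c, i)` to `(β, d, j)` if
`(α, c) = (β, d)` and `j = i + 1`, or if `i = |c|`, `j = 1` and there is an arc from `(α, c)` to
`(β, d)` in the digraph of states-and-cliques. -/
def ADSC : Digraph S.ADSCNode where
  Adj u w := (u.1 = w.1 ∧ (w.2 : ℕ) = (u.2 : ℕ) + 1) ∨
    ((u.2 : ℕ) = u.1.clique.length ∧ (w.2 : ℕ) = 1 ∧ S.DSC.Adj u.1 w.1)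

instance [Finite A] [Finite X] : Finite S.DSCNode := by
  have : Finite {c : TraceMonoid I // c.IsClique} := TraceMonoid.finite_isClique I
  refine Finite.of_injective
    (fun v : S.DSCNode => ((v.state, ⟨v.clique, v.2.1⟩) : X × {c : TraceMonoid I // c.IsClique})) ?_
  intro v w h
  obtain ⟨h1, h2⟩ := Prod.mk.inj h
  exact Subtype.ext (Prod.ext h1 (congrArg Subtype.val h2))

instance [Finite A] [Finite X] : Finite S.ADSCNode :=
  inferInstanceAs (Finite ((v : S.DSCNode) × {i : ℕ // i ∈ Finset.Icc 1 v.clique.length}))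

noncomputable instance [Finite A] [Finite X] : Fintype S.ADSCNode :=
  Fintype.ofFinite _

end ConcurrentSystem

/-! A non-empty execution from `α` splits uniquely as its first Cartier–Foata clique `c` followed by
an execution from `α · c` whose first clique `d`, if any, satisfies `c → d`. An arc `(α, c) → (β,
d)` thus advances the length by a whole clique; the augmented digraph cuts it into unit steps, so
that its walks measure length.

Precisely, let `e m` assign to `(α, c, i)` the number of executions from `α` of length `m + i` with
first clique `c`. With `N` the adjacency matrix, `N e m = e (m + 1)` (`mulVec_executionVector`),
hence `N ^ m e t = e (m + t)`. As `N` and `e` are non-negative, this bounds executions by walks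
(`executionVector_le`) and walks by executions (`pow_apply_le_executionVector`), up to constants and
bounded shifts of length. So both counts have the same exponential growth rate, which is `ρ` by
Gelfand's formula. -/

namespace TraceMonoid

variable {A : Type*} {I : SimpleGraph A}

/-- The trace that consists of a single letter. -/
def letter (I : SimpleGraph A) (a : A) : TraceMonoid I :=
  PresentedMonoid.of (TraceRel I) a

theorem ofWord_nil : ofWord I [] = 1 := rfl

theorem ofWord_cons (a : A) (w : List A) : ofWord I (a :: w) = letter I a * ofWord I w := rfl

theorem exists_ofWord (x : TraceMonoid I) : ∃ w, ofWord I w = x := by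
  induction x using PresentedMonoid.inductionOn with
  | _ w => exact ⟨FreeMonoid.toList w, rfl⟩

theorem letter_mul_comm {a b : A} (h : I.Adj a b) :
    letter I a * letter I b = letter I b * letter I a :=
  (Con.eq _).2 (ConGen.Rel.of _ _ (TraceRel.swap h))

theorem length_mul (x y : TraceMonoid I) : (x * y).length = x.length + y.length := by
  simp [length]

@[simp]
theorem length_one : (1 : TraceMonoid I).length = 0 := by
  simp [length]

theorem eq_one_of_length_eq_zero {x : TraceMonoid I} (h : x.length = 0) : x = 1 := by
  obtain ⟨w, rfl⟩ := exists_ofWord x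
  rw [length_ofWord, List.length_eq_zero_iff] at h
  rw [h, ofWord_nil]

theorem length_pos {x : TraceMonoid I} (h : x ≠ 1) : 0 < x.length :=
  Nat.pos_of_ne_zero fun h0 => h (eq_one_of_length_eq_zero h0)

theorem finite_length_eq [Finite A] (n : ℕ) : {x : TraceMonoid I | x.length = n}.Finite := by
  refine ((List.finite_length_eq A n).image (ofWord I)).subset ?_
  intro x hx
  obtain ⟨w, rfl⟩ := exists_ofWord x
  exact ⟨w, by simpa [length_ofWord] using hx, rfl⟩

/-! ### Projections to pairs of non-commuting letters; left cancellation -/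

section Projections

open Classical in
/-- The projection of traces to words over two letters `a`, `b` that do not commute. -/
noncomputable def proj {a b : A} (h : ¬ I.Adj a b) : TraceMonoid I →* FreeMonoid A :=
  PresentedMonoid.lift (fun c => if c = a ∨ c = b then FreeMonoid.of c else 1) (by
    rintro _ _ ⟨hcd⟩
    rename_i c d
    simp only [map_mul, FreeMonoid.lift_eval_of]
    have := hcd.symm
    split_ifs with h1 h2
    · exfalso
      rcases h1 with rfl | rfl <;> rcases h2 with rfl | rfl <;> simp_all
    all_goals simp)

open Classical in
theorem proj_letter {a b : A} (h : ¬ I.Adj a b) (c : A) :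
    proj h (letter I c) = if c = a ∨ c = b then FreeMonoid.of c else 1 := rfl

theorem head_proj_letter_mul {a b c : A} (h : ¬ I.Adj a b) (hc : c = a ∨ c = b)
    (x : TraceMonoid I) : (proj h (letter I c * x)).toList.head? = some c := by
  rw [map_mul, proj_letter, if_pos hc]
  rfl

theorem proj_letter_mul_of_ne {a b c : A} (h : ¬ I.Adj a b) (ha : c ≠ a) (hb : c ≠ b)
    (x : TraceMonoid I) : proj h (letter I c * x) = proj h x := by
  rw [map_mul, proj_letter, if_neg (by tauto), one_mul]

/-- The pair `(a, a)` forces `a` to occur; the pairs `(a, c)` force every letter before its first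
occurrence to commute with it, so `a` can be moved to the front. -/
theorem letter_dvd_iff_head_proj (a : A) (x : TraceMonoid I) :
    letter I a ∣ x ↔ ∀ (b : A) (h : ¬ I.Adj a b), (proj h x).toList.head? = some a := by
  constructor
  · rintro ⟨y, rfl⟩ b h
    exact head_proj_letter_mul h (Or.inl rfl) y
  · obtain ⟨w, rfl⟩ := exists_ofWord x
    induction w with
    | nil =>
      intro h
      simpa [ofWord_nil] using h a (I.irrefl)
    | cons c w ih =>
      intro h
      rw [ofWord_cons] at h ⊢
      by_cases hca : c = a
      · exact hca ▸ dvd_mul_right _ _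
      have hadj : I.Adj a c := by
        by_contra hn
        have := h c hn
        rw [head_proj_letter_mul hn (Or.inr rfl)] at this
        exact hca (Option.some.inj this)
      obtain ⟨y, hy⟩ := ih fun b hb => by
        have := h b hb
        rwa [proj_letter_mul_of_ne hb hca (by rintro rfl; exact hb hadj)] at this
      rw [hy, ← mul_assoc, ← letter_mul_comm hadj, mul_assoc]
      exact dvd_mul_right _ _

/-- Trace monoids embed in a product of free monoids, from which they inherit cancellation. The
heads of the projections reveal a common first letter, which is removed by induction. -/
theorem eq_of_proj_eq {x y : TraceMonoid I}
    (hxy : ∀ (a b : A) (h : ¬ I.Adj a b), proj h x = proj h y) : x = y := by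
  obtain ⟨w, rfl⟩ := exists_ofWord x
  induction w generalizing y with
  | nil =>
    obtain ⟨w', rfl⟩ := exists_ofWord y
    cases w' with
    | nil => rfl
    | cons c w' =>
      have h := head_proj_letter_mul (I := I) (a := c) (b := c) I.irrefl (Or.inl rfl) (ofWord I w')
      rw [← ofWord_cons, ← hxy, ofWord_nil, map_one] at h
      cases h
  | cons a w ih =>
    obtain ⟨z, rfl⟩ : letter I a ∣ y := by
      rw [letter_dvd_iff_head_proj]
      intro b h
      rw [← hxy, ofWord_cons, head_proj_letter_mul h (Or.inl rfl)]
    rw [ofWord_cons]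
    congr 1
    refine ih fun b c h => ?_
    have := hxy b c h
    rw [ofWord_cons, map_mul, map_mul] at this
    exact mul_left_cancel this

/-- Trace monoids are left cancellative. -/
theorem mul_right_injective (c : TraceMonoid I) : Function.Injective (c * ·) := by
  intro x y h
  refine eq_of_proj_eq fun a b hab => ?_
  have := congrArg (proj hab) h
  simp only [map_mul] at this
  exact mul_left_cancel this

end Projections

theorem letter_dvd_letter_mul {a b : A} {x : TraceMonoid I} :
    letter I a ∣ letter I b * x ↔ a = b ∨ (I.Adj b a ∧ letter I a ∣ x) := by
  constructor
  · intro h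
    by_cases hab : a = b
    · exact Or.inl hab
    have h' := (letter_dvd_iff_head_proj _ _).1 h
    have hadj : I.Adj a b := by
      by_contra hn
      have := h' b hn
      rw [head_proj_letter_mul hn (Or.inr rfl)] at this
      exact hab (Option.some.inj this).symm
    refine Or.inr ⟨hadj.symm, (letter_dvd_iff_head_proj _ _).2 fun c hc => ?_⟩
    rw [← h' c hc, proj_letter_mul_of_ne hc (Ne.symm hab) (by rintro rfl; exact hc hadj)]
  · rintro (rfl | ⟨hadj, y, rfl⟩)
    · exact dvd_mul_right _ _
    · rw [← mul_assoc, letter_mul_comm hadj, mul_assoc]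
      exact dvd_mul_right _ _

theorem letter_dvd_ofWord_mul {l : List A} (hl : l.Pairwise I.Adj) {a : A} {y : TraceMonoid I} :
    letter I a ∣ ofWord I l * y ↔ a ∈ l ∨ ((∀ b ∈ l, I.Adj b a) ∧ letter I a ∣ y) := by
  induction l with
  | nil => simp [ofWord_nil]
  | cons b l ih =>
    rw [List.pairwise_cons] at hl
    rw [ofWord_cons, mul_assoc, letter_dvd_letter_mul, ih hl.2, List.mem_cons, List.forall_mem_cons]
    have := hl.1 a
    tauto

theorem not_letter_dvd_one (a : A) : ¬ letter I a ∣ 1 := by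
  rintro ⟨y, hy⟩
  have h1 : (letter I a).length = 1 := length_ofWord [a]
  have := congrArg length hy
  rw [length_mul, length_one] at this
  omega

theorem letter_dvd_ofWord {l : List A} (hl : l.Pairwise I.Adj) {a : A} :
    letter I a ∣ ofWord I l ↔ a ∈ l := by
  have := letter_dvd_ofWord_mul hl (a := a) (y := 1)
  simpa [not_letter_dvd_one] using this

theorem ofWord_dvd {l : List A} (hl : l.Pairwise I.Adj) {x : TraceMonoid I}
    (h : ∀ a ∈ l, letter I a ∣ x) : ofWord I l ∣ x := by
  induction l generalizing x with
  | nil => exact one_dvd x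
  | cons b l ih =>
    rw [List.pairwise_cons] at hl
    obtain ⟨y, rfl⟩ := h b List.mem_cons_self
    refine mul_dvd_mul_left (letter I b) (ih hl.2 fun a ha => ?_)
    rcases letter_dvd_letter_mul.1 (h a (List.mem_cons_of_mem _ ha)) with rfl | h'
    · exact (I.irrefl (hl.1 a ha)).elim
    · exact h'.2

theorem ofWord_eq_of_mem_iff {l m : List A} (hl : l.Pairwise I.Adj) (hm : m.Pairwise I.Adj)
    (h : ∀ a, a ∈ l ↔ a ∈ m) : ofWord I l = ofWord I m := by
  have hlen : l.length = m.length :=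
    ((List.perm_ext_iff_of_nodup (hl.imp fun h => h.ne) (hm.imp fun h => h.ne)).2 h).length_eq
  obtain ⟨y, hy⟩ := ofWord_dvd hl fun a ha => (letter_dvd_ofWord hm).2 ((h a).1 ha)
  have hy0 := congrArg length hy
  rw [length_mul, length_ofWord, length_ofWord] at hy0
  rw [hy, eq_one_of_length_eq_zero (x := y) (by omega), mul_one]

/-! ### First clique of the Cartier–Foata normal form -/

section First

variable [Finite A]

/-- The letters that divide a trace on the left. -/
noncomputable def letters (x : TraceMonoid I) : Finset A :=
  (Set.toFinite {a | letter I a ∣ x}).toFinset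

theorem mem_letters {a : A} {x : TraceMonoid I} : a ∈ letters x ↔ letter I a ∣ x := by
  simp [letters]

theorem pairwise_letters (x : TraceMonoid I) : (letters x).toList.Pairwise I.Adj := by
  refine (Finset.nodup_toList _).imp_of_mem ?_
  intro a b ha hb hab
  rw [Finset.mem_toList, mem_letters] at ha hb
  obtain ⟨y, rfl⟩ := ha
  exact ((letter_dvd_letter_mul.1 hb).resolve_left hab.symm).1

/-- The first clique in the Cartier–Foata normal form of a trace. -/
noncomputable def first (x : TraceMonoid I) : TraceMonoid I :=
  ofWord I (letters x).toList

theorem isCliqueWord_first (x : TraceMonoid I) : IsCliqueWord (first x) (letters x).toList :=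
  ⟨pairwise_letters x, rfl⟩

theorem isClique_first (x : TraceMonoid I) : (first x).IsClique :=
  ⟨_, isCliqueWord_first x⟩

theorem first_dvd (x : TraceMonoid I) : first x ∣ x :=
  ofWord_dvd (pairwise_letters x) fun a ha => by rwa [Finset.mem_toList, mem_letters] at ha

theorem letter_dvd_first {a : A} {x : TraceMonoid I} : letter I a ∣ first x ↔ letter I a ∣ x := by
  rw [first, letter_dvd_ofWord (pairwise_letters x), Finset.mem_toList, mem_letters]

theorem first_ne_one {x : TraceMonoid I} (hx : x ≠ 1) : first x ≠ 1 := by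
  obtain ⟨w, rfl⟩ := exists_ofWord x
  cases w with
  | nil => exact (hx ofWord_nil).elim
  | cons a w =>
    intro h
    apply not_letter_dvd_one (I := I) a
    rw [← h, letter_dvd_first]
    exact ⟨_, ofWord_cons a w⟩

/-- A letter outside `c` divides `c * y` exactly when it divides `y` and commutes with all of `c`;
`NormalPair` says that there is no such letter. -/
theorem first_mul_eq_iff {c y : TraceMonoid I} (hc : c.IsClique) :
    first (c * y) = c ↔ NormalPair c (first y) := by
  constructor
  · intro h
    obtain ⟨l, hl, rfl⟩ := hc
    refine ⟨l, _, ⟨hl, rfl⟩, isCliqueWord_first y, fun b hb => ?_⟩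
    rw [Finset.mem_toList, mem_letters] at hb
    by_contra! hn
    have h1 : letter I b ∣ ofWord I l * y := (letter_dvd_ofWord_mul hl).2 (Or.inr ⟨hn, hb⟩)
    rw [← letter_dvd_first, h, letter_dvd_ofWord hl] at h1
    exact I.irrefl (hn b h1)
  · rintro ⟨l, m, ⟨hl, rfl⟩, ⟨hm, hy⟩, h⟩
    refine ofWord_eq_of_mem_iff (pairwise_letters _) hl fun a => ?_
    rw [Finset.mem_toList, mem_letters, letter_dvd_ofWord_mul hl, ← letter_dvd_first, hy,
      letter_dvd_ofWord hm]
    refine ⟨?_, Or.inl⟩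
    rintro (h1 | ⟨h1, h2⟩)
    · exact h1
    · obtain ⟨b, hb, hn⟩ := h a h2
      exact (hn (h1 b hb)).elim

theorem first_eq_self {c : TraceMonoid I} (hc : c.IsClique) : first c = c := by
  obtain ⟨l, hl, rfl⟩ := hc
  refine ofWord_eq_of_mem_iff (pairwise_letters _) hl fun a => ?_
  rw [Finset.mem_toList, mem_letters, letter_dvd_ofWord hl]

end First

end TraceMonoid

/-! ### Spectral radius and growth of powers -/

section GelfandBounds

open scoped NNReal
open Filter

variable {R : Type*} [NormedRing R] [NormedAlgebra ℂ R] [CompleteSpace R]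

theorem le_inv_spectralRadius_of_bound (a : R) (s K : ℝ≥0) (h : ∀ n : ℕ, ‖a ^ n‖₊ * s ^ n ≤ K) :
    (s : ℝ≥0∞) ≤ (spectralRadius ℂ a)⁻¹ := by
  rw [ENNReal.le_inv_iff_mul_le, spectralRadius, ENNReal.mul_iSup]
  refine iSup_le fun k => ?_
  rw [ENNReal.mul_iSup]
  refine iSup_le fun hk => ?_
  norm_cast
  by_contra! hlt
  obtain ⟨n, hn⟩ := pow_unbounded_of_one_lt (K * ‖(1 : R)‖₊) hlt
  -- The factor `‖1‖₊` is kept because the norm of the unit is not assumed to be `1`.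
  have h1 : ‖k ^ n‖₊ ≤ ‖a ^ n‖₊ * ‖(1 : R)‖₊ :=
    spectrum.norm_le_norm_mul_of_mem (spectrum.pow_mem_pow a n hk)
  refine hn.not_ge ?_
  calc (s * ‖k‖₊) ^ n = ‖k ^ n‖₊ * s ^ n := by rw [mul_pow, nnnorm_pow, mul_comm]
    _ ≤ ‖a ^ n‖₊ * ‖(1 : R)‖₊ * s ^ n := by gcongr
    _ = ‖a ^ n‖₊ * s ^ n * ‖(1 : R)‖₊ := by ring
    _ ≤ K * ‖(1 : R)‖₊ := by gcongr; exact h n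

theorem eventually_bound_of_lt_inv_spectralRadius (a : R) (s : ℝ≥0)
    (h : (s : ℝ≥0∞) < (spectralRadius ℂ a)⁻¹) : ∀ᶠ n : ℕ in atTop, ‖a ^ n‖₊ * s ^ n ≤ 1 := by
  rw [ENNReal.lt_inv_iff_lt_inv] at h
  filter_upwards [(spectrum.pow_nnnorm_pow_one_div_tendsto_nhds_spectralRadius a).eventually_lt_const
    h, eventually_gt_atTop 0] with n hn hpos
  have hn0 : (n : ℝ) ≠ 0 := by positivity
  have h1 : ((‖a ^ n‖₊ : ℝ≥0∞) ^ (1 / n : ℝ)) ^ n ≤ ((s : ℝ≥0∞)⁻¹) ^ n := by gcongr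
  rw [← ENNReal.rpow_natCast, ← ENNReal.rpow_mul, one_div_mul_cancel hn0, ENNReal.rpow_one,
    ← ENNReal.inv_pow, ENNReal.le_inv_iff_mul_le] at h1
  exact_mod_cast h1

end GelfandBounds

/-! ### Walk counts and the spectral radius of a digraph -/

namespace Digraph

open scoped NNReal
open Filter

variable {V : Type*} [Fintype V] (G : Digraph V)

open Classical in
/-- The adjacency matrix of a digraph, with natural number entries. -/
noncomputable def natAdjacencyMatrix : Matrix V V ℕ :=
  Matrix.of fun x y => if G.Adj x y then 1 else 0

open Classical in
/-- The number of walks with `m` arcs. -/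
noncomputable def walkCount (m : ℕ) : ℕ :=
  ∑ u, ∑ w, (G.natAdjacencyMatrix ^ m) u w

-- This norm is the maximal absolute row sum, so for powers of an adjacency matrix it equals the
-- walk count up to a factor `Fintype.card V`.
attribute [local instance] Matrix.linftyOpNormedRing Matrix.linftyOpNormedAlgebra

open Classical in
theorem adjacencyMatrix_pow_apply (m : ℕ) (u w : V) :
    (G.adjacencyMatrix ^ m) u w = ((G.natAdjacencyMatrix ^ m) u w : ℕ) := by
  have h : G.adjacencyMatrix = (Nat.castRingHom ℂ).mapMatrix G.natAdjacencyMatrix := by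
    ext u w
    simp [adjacencyMatrix, natAdjacencyMatrix]
  rw [h, ← map_pow]
  rfl

open Classical in
theorem nnnorm_adjacencyMatrix_pow (m : ℕ) :
    ‖G.adjacencyMatrix ^ m‖₊ =
      Finset.univ.sup fun u => ∑ w, ((G.natAdjacencyMatrix ^ m) u w : ℝ≥0) := by
  rw [Matrix.linfty_opNNNorm_def]
  simp [adjacencyMatrix_pow_apply]

open Classical in
theorem nnnorm_adjacencyMatrix_pow_le (m : ℕ) :
    ‖G.adjacencyMatrix ^ m‖₊ ≤ (G.walkCount m : ℝ≥0) := by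
  rw [nnnorm_adjacencyMatrix_pow, walkCount]
  push_cast
  exact Finset.sup_le fun u hu =>
    Finset.single_le_sum (f := fun u => ∑ w, ((G.natAdjacencyMatrix ^ m) u w : ℝ≥0))
      (fun _ _ => zero_le) hu

open Classical in
theorem walkCount_le (m : ℕ) :
    (G.walkCount m : ℝ≥0) ≤ Fintype.card V * ‖G.adjacencyMatrix ^ m‖₊ := by
  rw [nnnorm_adjacencyMatrix_pow, walkCount]
  push_cast
  rw [← nsmul_eq_mul, Fintype.card]
  exact Finset.sum_le_card_nsmul _ _ _ fun u hu =>
    Finset.le_sup (f := fun u => ∑ w, ((G.natAdjacencyMatrix ^ m) u w : ℝ≥0)) hu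

theorem le_inv_specRadius_of_bound (s K : ℝ≥0) (h : ∀ m : ℕ, G.walkCount m * s ^ m ≤ K) :
    (s : ℝ≥0∞) ≤ G.specRadius⁻¹ := by
  classical
  refine le_inv_spectralRadius_of_bound G.adjacencyMatrix s K fun n => le_trans ?_ (h n)
  gcongr
  exact G.nnnorm_adjacencyMatrix_pow_le n

theorem eventually_bound_of_lt_inv_specRadius (s : ℝ≥0) (h : (s : ℝ≥0∞) < G.specRadius⁻¹) :
    ∀ᶠ m : ℕ in atTop, G.walkCount m * s ^ m ≤ Fintype.card V := by
  classical
  filter_upwards [eventually_bound_of_lt_inv_spectralRadius G.adjacencyMatrix s h] with m hm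
  calc G.walkCount m * s ^ m ≤ Fintype.card V * ‖G.adjacencyMatrix ^ m‖₊ * s ^ m := by
        gcongr; exact G.walkCount_le m
    _ = Fintype.card V * (‖G.adjacencyMatrix ^ m‖₊ * s ^ m) := mul_assoc _ _ _
    _ ≤ Fintype.card V := mul_le_of_le_one_right zero_le hm

end Digraph

theorem exists_bound_of_lt_radius {c : ℕ → ℕ} {s : NNReal}
    (h : s < (FormalMultilinearSeries.ofScalars ℂ fun n => (c n : ℂ)).radius) :
    ∃ C : NNReal, ∀ n, (c n : NNReal) * s ^ n ≤ C := by
  obtain ⟨C, -, hC⟩ := FormalMultilinearSeries.nnnorm_mul_pow_le_of_lt_radius _ h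
  refine ⟨C, fun n => ?_⟩
  have := hC n
  rw [← NNReal.coe_le_coe, NNReal.coe_mul, coe_nnnorm, FormalMultilinearSeries.ofScalars_norm,
    Complex.norm_natCast] at this
  exact_mod_cast this

/-! ### Counting executions by walks -/

namespace ConcurrentSystem

open TraceMonoid Filter
open scoped NNReal

variable {A X : Type*} {I : SimpleGraph A} (S : ConcurrentSystem I X)

theorem act_ne_bot_of_mul {α : WithBot X} {x y : TraceMonoid I} (h : S.act α (x * y) ≠ ⊥) :
    S.act α x ≠ ⊥ := by
  intro hx
  rw [← S.act_mul, hx, S.act_bot] at h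
  exact h rfl

variable {S} in
theorem DSCNode.isClique_clique (v : S.DSCNode) : v.clique.IsClique := v.2.1

variable [Finite A]

variable {S} in
/-- The executions of length `k` from the state of a node whose first clique is that of the
node. -/
def executionsFrom (v : S.DSCNode) (k : ℕ) : Set (TraceMonoid I) :=
  {x | first x = v.clique ∧ S.act v.state x ≠ ⊥ ∧ x.length = k}

theorem finite_executions (α β : X) (n : ℕ) : (S.executions α β n).Finite :=
  (finite_length_eq n).subset fun _ hx => hx.2

variable {S} in
theorem finite_executionsFrom (v : S.DSCNode) (k : ℕ) : (executionsFrom v k).Finite :=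
  (finite_length_eq k).subset fun _ hx => hx.2.2

variable {S} in
theorem clique_mul_mem_executionsFrom_iff {v : S.DSCNode} {y : TraceMonoid I} {k : ℕ}
    (hy : y ≠ 1) :
    v.clique * y ∈ executionsFrom v (v.clique.length + k) ↔
      ∃ w, S.DSC.Adj v w ∧ y ∈ executionsFrom w k := by
  constructor
  · rintro ⟨h1, h2, h3⟩
    rw [first_mul_eq_iff v.isClique_clique] at h1
    obtain ⟨β, hβ⟩ := WithBot.ne_bot_iff_exists.1 (S.act_ne_bot_of_mul h2)
    rw [← S.act_mul, ← hβ] at h2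
    obtain ⟨z, hz⟩ := first_dvd y
    have hbot : S.act β (first y) ≠ ⊥ := by
      rw [hz] at h2
      exact S.act_ne_bot_of_mul h2
    refine ⟨⟨(β, first y), isClique_first y, first_ne_one hy, hbot⟩, ⟨hβ, h1⟩, rfl, h2, ?_⟩
    rw [length_mul] at h3
    omega
  · rintro ⟨w, ⟨h1, h2⟩, h3, h4, h5⟩
    refine ⟨?_, ?_, ?_⟩
    · rw [first_mul_eq_iff v.isClique_clique, h3]
      exact h2
    · rwa [← S.act_mul, ← h1]
    · rw [length_mul, h5]

variable [Finite X]

noncomputable instance : Fintype S.DSCNode :=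
  Fintype.ofFinite _

-- Left multiplication by the clique of `v` is a bijection: cancellation recovers the remainder `y`,
-- and the next node must be `(α · c, first y)`. The `m + 1` keeps `y` non-empty, so that this node
-- exists.
open Classical in
variable {S} in
theorem ncard_executionsFrom (v : S.DSCNode) (m : ℕ) :
    (executionsFrom v (v.clique.length + (m + 1))).ncard =
      ∑ w, if S.DSC.Adj v w then (executionsFrom w (m + 1)).ncard else 0 := by
  have hne : ∀ {w : S.DSCNode} {y}, y ∈ executionsFrom w (m + 1) → y ≠ 1 := by
    rintro w y ⟨-, -, h⟩ rfl
    simp at h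
  let e : (Σ w : {w // S.DSC.Adj v w}, executionsFrom w.1 (m + 1)) →
      executionsFrom v (v.clique.length + (m + 1)) := fun p =>
    ⟨v.clique * p.2.1, (clique_mul_mem_executionsFrom_iff (hne p.2.2)).2 ⟨p.1.1, p.1.2, p.2.2⟩⟩
  have he : Function.Bijective e := by
    constructor
    · rintro ⟨⟨w, hw⟩, y, hy⟩ ⟨⟨w', hw'⟩, y', hy'⟩ h
      obtain rfl : y = y' := TraceMonoid.mul_right_injective v.clique (congrArg Subtype.val h)
      obtain rfl : w = w' := Subtype.ext (Prod.ext (WithBot.coe_injective (hw.1.trans hw'.1.symm))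
        (hy.1.symm.trans hy'.1))
      rfl
    · rintro ⟨x, hx⟩
      obtain ⟨y, rfl⟩ : v.clique ∣ x := hx.1 ▸ first_dvd x
      have hy : y ≠ 1 := by
        rintro rfl
        have := hx.2.2
        rw [mul_one] at this
        omega
      obtain ⟨w, hw, hyw⟩ := (clique_mul_mem_executionsFrom_iff hy).1 hx
      exact ⟨⟨⟨w, hw⟩, y, hyw⟩, rfl⟩
  have (w : {w // S.DSC.Adj v w}) : Finite (executionsFrom w.1 (m + 1)) :=
    finite_executionsFrom w.1 (m + 1)
  rw [← Nat.card_coe_set_eq, ← Nat.card_congr (Equiv.ofBijective e he), Nat.card_sigma,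
    ← Finset.sum_filter]
  simp only [Nat.card_coe_set_eq]
  exact (Finset.sum_subtype _ (by simp) fun w => (executionsFrom w (m + 1)).ncard).symm

/-- The number of executions of length `m + i` that start with the clique of the node
`(α, c, i)`. -/
noncomputable def executionVector (m : ℕ) (u : S.ADSCNode) : ℕ :=
  (executionsFrom u.1 (m + u.2)).ncard

variable {S} in
/-- The first node `(α, c, 1)` above a node `(α, c)`. -/
def startNode (v : S.DSCNode) : S.ADSCNode :=
  ⟨v, 1, Finset.mem_Icc.2 ⟨le_rfl, length_pos v.2.2.1⟩⟩

theorem mulVec_executionVector (m : ℕ) :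
    S.ADSC.natAdjacencyMatrix.mulVec (S.executionVector m) = S.executionVector (m + 1) := by
  classical
  funext u
  have hsum : S.ADSC.natAdjacencyMatrix.mulVec (S.executionVector m) u =
      ∑ w, if S.ADSC.Adj u w then S.executionVector m w else 0 := by
    simp [Matrix.mulVec, dotProduct, Digraph.natAdjacencyMatrix]
  rw [hsum]
  obtain ⟨v, i, hi⟩ := u
  have hi' := Finset.mem_Icc.1 hi
  rcases hi'.2.lt_or_eq with hlt | heq
  -- Inside a clique the only arc raises `i` by one, and `m + (i + 1) = (m + 1) + i`.
  · let w₀ : S.ADSCNode := ⟨v, i + 1, Finset.mem_Icc.2 ⟨by omega, hlt⟩⟩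
    have hadj : ∀ w, S.ADSC.Adj ⟨v, i, hi⟩ w ↔ w = w₀ := by
      rintro ⟨w, j, hj⟩
      constructor
      · rintro (⟨h1, h2⟩ | ⟨h, -⟩)
        · obtain rfl : v = w := h1
          obtain rfl : j = i + 1 := h2
          rfl
        · exact (hlt.ne h).elim
      · rintro h
        rw [h]
        exact Or.inl ⟨rfl, rfl⟩
    simp only [hadj, Finset.sum_ite_eq', Finset.mem_univ, if_true]
    change (executionsFrom v (m + (i + 1))).ncard = (executionsFrom v (m + 1 + i)).ncard
    rw [Nat.add_right_comm, Nat.add_assoc]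
  · have h := ncard_executionsFrom v m
    rw [← heq, Nat.add_comm] at h
    change _ = (executionsFrom v (m + 1 + i)).ncard
    rw [h]
    symm
    -- From the end of a clique, arcs reach only nodes with index `1`, so the sum runs over the
    -- digraph of states-and-cliques.
    refine Fintype.sum_of_injective (startNode (S := S)) (fun v w h => congrArg Sigma.fst h) _ _
      ?_ fun w => ?_
    · rintro ⟨w, j, hj⟩ hw
      refine if_neg ?_
      rintro (⟨h1, h2⟩ | ⟨-, h2, -⟩)
      · obtain rfl : v = w := h1
        have h2' : j = i + 1 := h2
        have := (Finset.mem_Icc.1 hj).2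
        omega
      · obtain rfl : j = 1 := h2
        exact hw ⟨w, rfl⟩
    · have : S.ADSC.Adj ⟨v, i, hi⟩ (startNode w) ↔ S.DSC.Adj v w := by
        constructor
        · rintro (⟨-, h2⟩ | ⟨-, -, h⟩)
          · have h2' : 1 = i + 1 := h2
            omega
          · exact h
        · exact fun h => Or.inr ⟨heq, rfl, h⟩
      rw [if_congr this rfl rfl]
      simp only [executionVector, startNode]

theorem pow_mulVec_executionVector [DecidableEq S.ADSCNode] (m t : ℕ) :
    (S.ADSC.natAdjacencyMatrix ^ m).mulVec (S.executionVector t) = S.executionVector (m + t) := by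
  induction m with
  | zero => simp
  | succ m ih =>
    rw [pow_succ', ← Matrix.mulVec_mulVec, ih, mulVec_executionVector, Nat.add_right_comm]

theorem executionVector_le (m : ℕ) (u : S.ADSCNode) :
    S.executionVector m u ≤ S.ADSC.walkCount m * ∑ w, S.executionVector 0 w := by
  classical
  have h := S.pow_mulVec_executionVector m 0
  rw [add_zero] at h
  rw [← h, Finset.mul_sum]
  refine Finset.sum_le_sum fun w hw => Nat.mul_le_mul_right _ ?_
  calc (S.ADSC.natAdjacencyMatrix ^ m) u w ≤ ∑ w, (S.ADSC.natAdjacencyMatrix ^ m) u w :=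
        Finset.single_le_sum (f := fun w => (S.ADSC.natAdjacencyMatrix ^ m) u w)
          (fun _ _ => Nat.zero_le _) hw
    _ ≤ S.ADSC.walkCount m := by
        unfold Digraph.walkCount
        convert Finset.single_le_sum (f := fun u => ∑ w, (S.ADSC.natAdjacencyMatrix ^ m) u w)
          (fun _ _ => Nat.zero_le _) (Finset.mem_univ u)

theorem pow_apply_le_executionVector [DecidableEq S.ADSCNode] (m : ℕ) (u w : S.ADSCNode) :
    (S.ADSC.natAdjacencyMatrix ^ m) u w ≤
      S.executionVector (m + (w.1.clique.length - w.2)) u := by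
  -- The shift makes the counted length equal to `|c|`, where `c` itself is an execution.
  have hw : 1 ≤ S.executionVector (w.1.clique.length - w.2) w := by
    rw [executionVector, Nat.sub_add_cancel (Finset.mem_Icc.1 w.2.2).2, Nat.one_le_iff_ne_zero]
    exact Set.ncard_ne_zero_of_mem (a := w.1.clique) ⟨first_eq_self w.1.isClique_clique, w.1.2.2.2, rfl⟩
      (finite_executionsFrom _ _)
  rw [← pow_mulVec_executionVector]
  calc _ ≤ (S.ADSC.natAdjacencyMatrix ^ m) u w * S.executionVector (w.1.clique.length - w.2) w :=
        Nat.le_mul_of_pos_right _ hw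
    _ ≤ _ := Finset.single_le_sum (f := fun w' => (S.ADSC.natAdjacencyMatrix ^ m) u w' *
        S.executionVector (w.1.clique.length - w.2) w') (fun _ _ => Nat.zero_le _)
        (Finset.mem_univ w)

theorem ncard_executions_le (α β : X) (m : ℕ) :
    (S.executions α β (m + 1)).ncard ≤
      ∑ v : S.DSCNode, S.executionVector m (startNode v) := by
  have hsub : S.executions α β (m + 1) ⊆ ⋃ v : S.DSCNode, executionsFrom v (m + 1) := by
    rintro x ⟨h1, h2⟩
    have hx : x ≠ 1 := by
      rintro rfl
      simp at h2
    have hbot : S.act α x ≠ ⊥ := h1 ▸ WithBot.coe_ne_bot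
    have hbot' : S.act α (first x) ≠ ⊥ := by
      obtain ⟨z, hz⟩ := first_dvd x
      rw [hz] at hbot
      exact S.act_ne_bot_of_mul hbot
    exact Set.mem_iUnion.2 ⟨⟨(α, first x), isClique_first x, first_ne_one hx, hbot'⟩,
      rfl, hbot, h2⟩
  calc _ ≤ (⋃ v : S.DSCNode, executionsFrom v (m + 1)).ncard :=
        Set.ncard_le_ncard hsub (Set.finite_iUnion fun v => finite_executionsFrom v _)
    _ ≤ _ := Set.ncard_iUnion_le_of_fintype _

theorem executionVector_le_sum [Fintype X] (m : ℕ) (u : S.ADSCNode) :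
    S.executionVector m u ≤ ∑ β, (S.executions u.1.state β (m + u.2)).ncard := by
  have hsub : executionsFrom u.1 (m + u.2) ⊆ ⋃ β, S.executions u.1.state β (m + u.2) := by
    rintro x ⟨-, h1, h2⟩
    obtain ⟨β, hβ⟩ := WithBot.ne_bot_iff_exists.1 h1
    exact Set.mem_iUnion.2 ⟨β, hβ.symm, h2⟩
  calc _ ≤ (⋃ β, S.executions u.1.state β (m + u.2)).ncard :=
        Set.ncard_le_ncard hsub (Set.finite_iUnion fun β => S.finite_executions _ _ _)
    _ ≤ _ := Set.ncard_iUnion_le_of_fintype _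

/-! ### Comparison of the two radii -/

theorem le_characteristicRoot (s : ℝ≥0) (hs : (s : ℝ≥0∞) < S.ADSC.specRadius⁻¹) :
    (s : ℝ≥0∞) ≤ S.characteristicRoot := by
  obtain ⟨N, hN⟩ := eventually_atTop.1 (S.ADSC.eventually_bound_of_lt_inv_specRadius s hs)
  let E : ℝ≥0 := Fintype.card S.DSCNode * ((∑ w, S.executionVector 0 w : ℕ) : ℝ≥0)
  refine le_iInf₂ fun α β => FormalMultilinearSeries.le_radius_of_eventually_le _
    (((Fintype.card S.ADSCNode : ℝ≥0) * (E * s) : ℝ≥0) : ℝ) ?_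
  filter_upwards [eventually_ge_atTop (N + 1)] with n hn
  obtain ⟨m, rfl⟩ : ∃ m, n = m + 1 := ⟨n - 1, by omega⟩
  rw [FormalMultilinearSeries.ofScalars_norm, Complex.norm_natCast]
  have h1 : (S.executions α β (m + 1)).ncard ≤
      Fintype.card S.DSCNode * (S.ADSC.walkCount m * ∑ w, S.executionVector 0 w) :=
    (S.ncard_executions_le α β m).trans
      (Finset.sum_le_card_nsmul _ _ _ fun v _ => S.executionVector_le m _)
  have h2 : ((S.executions α β (m + 1)).ncard : ℝ≥0) * s ^ (m + 1) ≤
      Fintype.card S.ADSCNode * (E * s) :=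
    calc ((S.executions α β (m + 1)).ncard : ℝ≥0) * s ^ (m + 1)
        ≤ (Fintype.card S.DSCNode * (S.ADSC.walkCount m * ∑ w, S.executionVector 0 w) : ℕ) *
            s ^ (m + 1) := by gcongr
      _ = S.ADSC.walkCount m * s ^ m * (E * s) := by
          simp only [E]
          push_cast
          ring
      _ ≤ Fintype.card S.ADSCNode * (E * s) := by
          gcongr
          exact hN m (by omega)
  exact_mod_cast h2

theorem le_inv_specRadius (s : ℝ≥0) (hs : (s : ℝ≥0∞) < S.characteristicRoot) :
    (s : ℝ≥0∞) ≤ S.ADSC.specRadius⁻¹ := by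
  classical
  have := Fintype.ofFinite X
  rcases eq_or_ne s 0 with rfl | hs0
  · simp
  have hbound : ∀ α β : X, ∃ C : ℝ≥0, ∀ n, ((S.executions α β n).ncard : ℝ≥0) * s ^ n ≤ C := by
    intro α β
    have hle : S.characteristicRoot ≤ S.growthRadius α β :=
      (iInf_le (fun α => ⨅ β, S.growthRadius α β) α).trans (iInf_le (S.growthRadius α) β)
    exact exists_bound_of_lt_radius (hs.trans_le hle)
  choose C hC using hbound
  have hvec : ∀ k (u : S.ADSCNode), (S.executionVector k u : ℝ≥0) * s ^ (k + (u.2 : ℕ)) ≤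
      ∑ β, C u.1.state β := by
    intro k u
    calc (S.executionVector k u : ℝ≥0) * s ^ (k + (u.2 : ℕ))
        ≤ (∑ β, (S.executions u.1.state β (k + u.2)).ncard : ℕ) * s ^ (k + (u.2 : ℕ)) := by
          gcongr
          exact S.executionVector_le_sum k u
      _ = ∑ β, ((S.executions u.1.state β (k + u.2)).ncard : ℝ≥0) * s ^ (k + (u.2 : ℕ)) := by
          push_cast
          rw [Finset.sum_mul]
      _ ≤ ∑ β, C u.1.state β := Finset.sum_le_sum fun β _ => hC _ _ _
  let t : S.ADSCNode → ℕ := fun w => w.1.clique.length - w.2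
  refine S.ADSC.le_inv_specRadius_of_bound s
    -- Walks of `m` arcs from `u` to `w` are bounded by executions of length `m + t w + u.2`; the
    -- inverse power of `s` undoes this shift, whence the separate case `s = 0`.
    (∑ u : S.ADSCNode, ∑ w, (∑ β, C u.1.state β) * (s ^ (t w + (u.2 : ℕ)))⁻¹) fun m => ?_
  rw [Digraph.walkCount]
  push_cast
  rw [Finset.sum_mul]
  refine Finset.sum_le_sum fun u _ => ?_
  rw [Finset.sum_mul]
  refine Finset.sum_le_sum fun w _ => ?_
  rw [← div_eq_mul_inv, le_div_iff₀ (pow_pos (pos_iff_ne_zero.2 hs0) _), mul_assoc, ← pow_add,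
    ← add_assoc]
  refine le_trans ?_ (hvec (m + t w) u)
  gcongr
  exact S.pow_apply_le_executionVector m u w

theorem characteristicRoot_eq_inv_specRadius :
    S.characteristicRoot = S.ADSC.specRadius⁻¹ :=
  le_antisymm (ENNReal.le_of_forall_nnreal_lt S.le_inv_specRadius)
    (ENNReal.le_of_forall_nnreal_lt S.le_characteristicRoot)

end ConcurrentSystem

theorem mainTheorem8 {A X : Type*} [Finite A] [Finite X] (I : SimpleGraph A)
    (S : ConcurrentSystem I X) :
    (S.ADSC.specRadius ≠ 0 → S.characteristicRoot = 1 / S.ADSC.specRadius) ∧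
      (S.ADSC.specRadius = 0 → S.characteristicRoot = ⊤) := by
  rw [S.characteristicRoot_eq_inv_specRadius]
  exact ⟨fun _ => (one_div _).symm, fun h => by rw [h, ENNReal.inv_zero]⟩
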